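/- Let $1\le p<\infty$ and let $X$ be a (real or complex) Banach space. Notation: $B_Y$ is the closed unit ball of $Y$, and an operator is a continuous linear map. A sequence $(x_n)$ in a Banach space $E$ is weakly $p$-summable if $(x^*(x_n))_n\in\ell_p$ for every $x^*\in E^*$; an operator is $p$-convergent if it maps weakly $p$-summable sequences to norm null sequences. A set $S\subseteq E$ is weakly precompact if every sequence from $S$ has a weakly Cauchy subsequence; an operator $T:Y\to X$ is weakly precompact (resp. weakly compact, resp. compact) if $T(B_Y)$ is weakly precompact (resp. relatively weakly compact, resp. relatively norm compact). A bounded set $A\subseteq X$ is a weakly-$p$-Dunford–Pettis set if $\sup_{x\in A}|x_n^*(x)|\to 0$ for every weakly $p$-summable sequence $(x_n^*)$ in $X^*$. The space $X$ has property $RDP^*_p$ if every weakly-$p$-Dunford–Pettis subset of $X$ is relatively weakly compact. **Theorem.** The following statements are equivalent: (i) for every Banach space $Y$ and every operator $T:Y\to X$ whose adjoint $T^*:X^*\to Y^*$ is $p$-convergent, $T$ is weakly precompact (weakly compact, resp. compact); (ii) every operator $T:\ell_1\to X$ whose adjoint $T^*:X^*\to \ell_1^*$ is $p$-convergent is weakly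 precompact (weakly compact, resp. compact); (iii) every weakly-$p$-Dunford–Pettis subset of $X$ is weakly precompact (relatively weakly compact, resp. relatively compact). (These are three separate equivalences, one for each of the three readings.) In particular, in the weakly compact reading, (i) and (ii) are each equivalent to $X$ having property $RDP^*_p$. -/

import Mathlib

open Filter Topology
open scoped ENNReal

universe u v

section BanachSpaceNotions

variable {𝕜 : Type*} [RCLike 𝕜]
variable {E : Type*} [NormedAddCommGroup E] [NormedSpace 𝕜 E]
variable {F : Type*} [NormedAddCommGroup F] [NormedSpace 𝕜 F]

/-- The sequence `x` in `E` is weakly `p`-summable: the scalar sequence `(f (x n))` belongs to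
`ℓ_p` for every continuous linear functional `f` on `E`. -/
def WeaklyPSummable (𝕜 : Type*) [RCLike 𝕜] {E : Type*} [NormedAddCommGroup E] [NormedSpace 𝕜 E]
    (p : ℝ≥0∞) (x : ℕ → E) : Prop :=
  ∀ f : StrongDual 𝕜 E, Memℓp (fun n => f (x n)) p

/-- The operator `T` is `p`-convergent: it maps weakly `p`-summable sequences to norm null
sequences. -/
def IsPConvergent (p : ℝ≥0∞) (T : E →L[𝕜] F) : Prop :=
  ∀ x : ℕ → E, WeaklyPSummable 𝕜 p x → Tendsto (fun n => T (x n)) atTop (𝓝 0)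

/-- The Banach space adjoint `T^* : F^* → E^*`, `f ↦ f ∘ T`, of the operator `T : E → F`. -/
noncomputable def banachAdjoint (T : E →L[𝕜] F) : StrongDual 𝕜 F →L[𝕜] StrongDual 𝕜 E :=
  ContinuousLinearMap.precomp 𝕜 T

theorem banachAdjoint_apply (T : E →L[𝕜] F) (f : StrongDual 𝕜 F) (x : E) :
    banachAdjoint T f x = f (T x) := rfl

/-- The sequence `x` in `E` is weakly Cauchy: `(f (x n))` is a Cauchy sequence of scalars for
every continuous linear functional `f` on `E`. -/
def WeaklyCauchySeq (𝕜 : Type*) [RCLike 𝕜] {E : Type*} [NormedAddCommGroup E] [NormedSpace 𝕜 E]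
    (x : ℕ → E) : Prop :=
  ∀ f : StrongDual 𝕜 E, CauchySeq (fun n => f (x n))

/-- The set `S` is weakly precompact: every sequence from `S` has a weakly Cauchy subsequence. -/
def IsWeaklyPrecompact (𝕜 : Type*) [RCLike 𝕜] {E : Type*} [NormedAddCommGroup E]
    [NormedSpace 𝕜 E] (S : Set E) : Prop :=
  ∀ x : ℕ → E, (∀ n, x n ∈ S) → ∃ φ : ℕ → ℕ, StrictMono φ ∧ WeaklyCauchySeq 𝕜 (x ∘ φ)

/-- The set `S` is relatively weakly compact: its closure in the weak topology of `E` is compact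
in the weak topology. -/
def IsRelativelyWeaklyCompact (𝕜 : Type*) [RCLike 𝕜] {E : Type*} [NormedAddCommGroup E]
    [NormedSpace 𝕜 E] (S : Set E) : Prop :=
  IsCompact (closure (toWeakSpace 𝕜 E '' S))

/-- The set `S` is relatively (norm) compact. -/
def IsRelativelyNormCompact (S : Set E) : Prop :=
  IsCompact (closure S)

/-- The operator `T` is weakly precompact: it maps the closed unit ball to a weakly precompact
set. -/
def IsWeaklyPrecompactOperator (T : E →L[𝕜] F) : Prop :=
  IsWeaklyPrecompact 𝕜 (T '' Metric.closedBall (0 : E) 1)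

/-- The operator `T` is weakly compact: it maps the closed unit ball to a relatively weakly
compact set. -/
def IsWeaklyCompactOperator (T : E →L[𝕜] F) : Prop :=
  IsRelativelyWeaklyCompact 𝕜 (T '' Metric.closedBall (0 : E) 1)

/-- The set `A` is a weakly-`p`-Dunford–Pettis set: `A` is bounded and every weakly `p`-summable
sequence in the dual tends to `0` uniformly on `A`.
The supremum is a genuine one, since `A` is bounded (and it is `0` for empty `A`). -/
def IsWeaklyPDunfordPettis (𝕜 : Type*) [RCLike 𝕜] {E : Type*} [NormedAddCommGroup E]
    [NormedSpace 𝕜 E] (p : ℝ≥0∞) (A : Set E) : Prop :=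
  Bornology.IsBounded A ∧
    ∀ f : ℕ → StrongDual 𝕜 E, WeaklyPSummable 𝕜 p f →
      Tendsto (fun n => ⨆ x : A, ‖f n (x : E)‖) atTop (𝓝 0)

/-- Property `RDP*_p`: every weakly-`p`-Dunford–Pettis subset is relatively weakly compact. -/
def HasRDPStar (𝕜 : Type*) [RCLike 𝕜] (E : Type*) [NormedAddCommGroup E] [NormedSpace 𝕜 E]
    (p : ℝ≥0∞) : Prop :=
  ∀ A : Set E, IsWeaklyPDunfordPettis 𝕜 p A → IsRelativelyWeaklyCompact 𝕜 A

end BanachSpaceNotions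

/-!
The three equivalences have a common proof. For a bounded operator `T : Y → X` and a sequence
`f` in `X^*`, the number `‖T^* (f n)‖` is the supremum of `‖f n‖` over `T(B_Y)`; hence `T^*` is
`p`-convergent exactly when `T(B_Y)` is a weakly-`p`-Dunford–Pettis set, and statements about all
such sets apply to `T(B_Y)`. Conversely, if `x` is a sequence in a weakly-`p`-Dunford–Pettis set
`A`, the operator `ℓ₁ → X` sending the unit vector `e n` to `x n` has a `p`-convergent adjoint,
because `‖T^* f‖ ≤ sup_A ‖f‖`, and its image of the unit ball contains every `x n`
(`IsWeaklyPDunfordPettis.exists_lp_one_operator`). So every sequence in `A` lies in a set with the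
compactness property in question, and it remains to see that each of the three properties of a
bounded set is determined by sequences (`tfae_of_sequential`). For weak precompactness this is the
definition, for norm compactness it is an approximation argument, and for weak compactness it is
Eberlein's theorem (`isRelativelyWeaklyCompact_of_forall_mapClusterPt`).

Eberlein's theorem is proved by Whitley's argument. By Banach–Alaoglu it suffices that every `φ` in
the weak-star closure of `A` in the bidual comes from `X`. One chooses a sequence `a` in `A`
inductively such that `a n` approximates `φ` on a finite set of functionals norming, up to a factor
`2`, the finite-dimensional space spanned by `φ` and the earlier terms of `a`. A weak cluster point
`x` of `a` lies in the closed span of `a`, so the functionals chosen still norm `φ - x`; but `φ - x`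
vanishes on all of them.
-/

section Eberlein

/-! ### Eberlein's theorem -/

variable {𝕜 : Type*} [RCLike 𝕜] {E : Type*} [NormedAddCommGroup E] [NormedSpace 𝕜 E]

/-- Finitely many vectors of the unit ball norm a finite-dimensional space of functionals, up to a
factor `2`, by compactness of its unit sphere. -/
theorem exists_finset_norming {S : Set (StrongDual 𝕜 E)} (hS : S.Finite) :
    ∃ F : Finset E, (∀ e ∈ F, ‖e‖ ≤ 1) ∧
      ∀ φ ∈ Submodule.span 𝕜 S, ∃ e ∈ F, ‖φ‖ ≤ 2 * ‖φ e‖ := by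
  classical
  set V := Submodule.span 𝕜 S
  have : FiniteDimensional 𝕜 V := FiniteDimensional.span_of_finite 𝕜 hS
  have : ProperSpace V := FiniteDimensional.proper 𝕜 V
  have hcpt : IsCompact (Metric.sphere (0 : V) 1) := isCompact_sphere 0 1
  obtain ⟨t, ht⟩ := hcpt.elim_finite_subcover
    (fun e : Metric.closedBall (0 : E) 1 => {φ : V | 1 / 2 < ‖(φ : StrongDual 𝕜 E) e‖})
    (fun e => isOpen_lt continuous_const (by fun_prop)) (by
      intro φ hφ
      have hφ1 : ‖(φ : StrongDual 𝕜 E)‖ = 1 := mem_sphere_zero_iff_norm.1 hφ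
      obtain ⟨e, he, he'⟩ := (φ : StrongDual 𝕜 E).exists_lt_apply_of_lt_opNorm
        (r := 1 / 2) (by rw [hφ1]; norm_num)
      exact Set.mem_iUnion.2 ⟨⟨e, by simpa using he.le⟩, he'⟩)
  refine ⟨insert 0 (t.image Subtype.val), ?_, fun φ hφ => ?_⟩
  · intro e he
    simp only [Finset.mem_insert, Finset.mem_image] at he
    rcases he with rfl | ⟨e, -, rfl⟩
    · simp
    · exact mem_closedBall_zero_iff.1 e.2
  · rcases eq_or_ne φ 0 with rfl | h0
    · exact ⟨0, Finset.mem_insert_self _ _, by simp⟩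
    have hn : ‖φ‖ ≠ 0 := norm_ne_zero_iff.2 h0
    let ψ : V := ((‖φ‖⁻¹ : ℝ) : 𝕜) • ⟨φ, hφ⟩
    have hψ : ψ ∈ Metric.sphere (0 : V) 1 := by
      suffices h : ‖ψ‖ = 1 from (mem_sphere_zero_iff_norm (a := ψ)).2 h
      change ‖((‖φ‖⁻¹ : ℝ) : 𝕜) • φ‖ = 1
      rw [norm_smul, RCLike.norm_ofReal, abs_of_nonneg (by positivity), inv_mul_cancel₀ hn]
    obtain ⟨e, het, he⟩ := Set.mem_iUnion₂.1 (ht hψ)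
    refine ⟨e, Finset.mem_insert_of_mem (Finset.mem_image_of_mem _ het), ?_⟩
    have he' : 1 / 2 < ‖φ‖⁻¹ * ‖φ e‖ := by
      simpa [ψ, norm_smul] using he
    rw [inv_mul_eq_div, lt_div_iff₀ (by positivity)] at he'
    linarith

/-- A weak cluster point of a sequence lies in the norm closed linear span of the sequence
(Mazur's theorem). -/
theorem mem_closure_span_of_mapClusterPt {a : ℕ → E} {x : E}
    (hx : MapClusterPt (toWeakSpace 𝕜 E x) atTop (fun n => toWeakSpace 𝕜 E (a n))) :
    x ∈ closure (Submodule.span 𝕜 (Set.range a) : Set E) := by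
  let _ : NormedSpace ℝ E := NormedSpace.restrictScalars ℝ 𝕜 E
  have : IsScalarTower ℝ 𝕜 E := Real.isScalarTower
  have hconv : Convex ℝ (Submodule.span 𝕜 (Set.range a) : Set E) :=
    ((Submodule.span 𝕜 (Set.range a)).restrictScalars ℝ).convex
  have hmem : toWeakSpace 𝕜 E x ∈
      closure (toWeakSpace 𝕜 E '' (Submodule.span 𝕜 (Set.range a) : Set E)) := by
    rw [mem_closure_iff_clusterPt]
    refine ClusterPt.mono hx ?_
    rw [le_principal_iff, mem_map]
    exact Eventually.of_forall fun n =>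
      ⟨a n, Submodule.subset_span ⟨n, rfl⟩, rfl⟩
  rw [← hconv.toWeakSpace_closure 𝕜] at hmem
  obtain ⟨y, hy, hyx⟩ := hmem
  rwa [← (toWeakSpace 𝕜 E).injective hyx]

/-- If `f (a n)` converges, its limit is the value of `f` at any weak cluster point of `a`. -/
theorem eq_of_mapClusterPt_of_tendsto {a : ℕ → E} {x : E}
    (hx : MapClusterPt (toWeakSpace 𝕜 E x) atTop (fun n => toWeakSpace 𝕜 E (a n)))
    (f : StrongDual 𝕜 E) {c : 𝕜} (hc : Tendsto (fun n => f (a n)) atTop (𝓝 c)) : f x = c := by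
  have hf : Continuous fun y : WeakSpace 𝕜 E => f ((toWeakSpace 𝕜 E).symm y) :=
    WeakBilin.eval_continuous (topDualPairing 𝕜 E).flip f
  have h : MapClusterPt (f x) atTop (fun n => f (a n)) :=
    hx.continuousAt_comp (f := fun y : WeakSpace 𝕜 E => f ((toWeakSpace 𝕜 E).symm y))
      hf.continuousAt
  by_contra hne
  exact h.clusterPt.neBot.ne (disjoint_iff.1 ((disjoint_nhds_nhds.2 hne).mono_right hc))

open NormedSpace in
/-- Whitley's construction: a point of the bidual that is a weak-star limit of points of `A` comes
from the space itself, if every sequence in `A` has a weak cluster point. -/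
theorem mem_range_inclusionInDoubleDual_of_forall_mapClusterPt {A : Set E}
    (hA : ∀ a : ℕ → E, (∀ n, a n ∈ A) →
      ∃ x, MapClusterPt (toWeakSpace 𝕜 E x) atTop (fun n => toWeakSpace 𝕜 E (a n)))
    (φ : StrongDual 𝕜 (StrongDual 𝕜 E))
    (hφ : ∀ (F : Finset (StrongDual 𝕜 E)) (ε : ℝ), 0 < ε → ∃ a ∈ A, ∀ f ∈ F, ‖φ f - f a‖ < ε) :
    ∃ x, inclusionInDoubleDual 𝕜 E x = φ := by
  classical
  let J := inclusionInDoubleDual 𝕜 E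
  choose N hN1 hN2 using fun s : Finset E =>
    exists_finset_norming (𝕜 := 𝕜) ((s.finite_toSet.image J).insert φ)
  -- Norming sets for all subsets of `s` are used, so that `M` is monotone.
  let M : Finset E → Finset (StrongDual 𝕜 E) := fun s => s.powerset.biUnion N
  have hM : ∀ {s t : Finset E}, s ⊆ t → M s ⊆ M t := fun h =>
    Finset.biUnion_subset_biUnion_of_subset_left _ (Finset.powerset_mono.2 h)
  have hNM : ∀ s, N s ⊆ M s := fun s =>
    Finset.subset_biUnion_of_mem N (Finset.mem_powerset_self s)
  choose b hbA hb using fun (s : Finset E) (n : ℕ) =>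
    hφ (M s) (1 / ((n : ℝ) + 1)) (by positivity)
  obtain ⟨s, hs⟩ : ∃ s : ℕ → Finset E, ∀ n, s (n + 1) = insert (b (s n) n) (s n) :=
    ⟨fun n => Nat.rec ∅ (fun n t => insert (b t n) t) n, fun n => rfl⟩
  let a : ℕ → E := fun n => b (s n) n
  have hmono : Monotone s := monotone_nat_of_le_succ fun n => by
    rw [hs]; exact Finset.subset_insert _ _
  obtain ⟨x, hx⟩ := hA a fun n => hbA _ _
  have hzero : ∀ m, ∀ f ∈ M (s m), f x = φ f := by
    intro m f hf
    refine eq_of_mapClusterPt_of_tendsto hx f ?_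
    rw [tendsto_iff_norm_sub_tendsto_zero]
    refine squeeze_zero' (Eventually.of_forall fun _ => norm_nonneg _) ?_
      tendsto_one_div_add_atTop_nhds_zero_nat
    filter_upwards [eventually_ge_atTop m] with n hn
    rw [norm_sub_rev]
    exact (hb (s n) n f (hM (hmono hn) hf)).le
  have hspan : ∀ y ∈ Submodule.span 𝕜 (Set.range a),
      ∃ m, y ∈ Submodule.span 𝕜 (s m : Set E) := by
    have hspan_mono : Monotone fun m => Submodule.span 𝕜 (s m : Set E) := fun _ _ hij =>
      Submodule.span_mono (Finset.coe_subset.2 (hmono hij))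
    intro y hy
    rw [← Submodule.mem_iSup_of_directed _ hspan_mono.directed_le]
    refine Submodule.span_le.2 ?_ hy
    rintro _ ⟨n, rfl⟩
    exact Submodule.mem_iSup_of_mem (n + 1)
      (Submodule.subset_span (by simp [hs, a]))
  refine ⟨x, ?_⟩
  suffices h : ‖J x - φ‖ = 0 from sub_eq_zero.1 (norm_eq_zero.1 h)
  refine le_antisymm (le_of_forall_pos_le_add fun ε hε => ?_) (norm_nonneg (J x - φ))
  obtain ⟨y, hy, hxy⟩ := Metric.mem_closure_iff.1 (mem_closure_span_of_mapClusterPt hx) (ε / 3)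
    (by positivity)
  obtain ⟨m, hm⟩ := hspan y hy
  have hyV : J y - φ ∈ Submodule.span 𝕜 (insert φ (J '' (s m : Set E))) := by
    refine Submodule.sub_mem (M := StrongDual 𝕜 (StrongDual 𝕜 E)) _ ?_ (Submodule.subset_span (Set.mem_insert φ _))
    have hJy := Submodule.mem_map_of_mem (f := J.toLinearMap) hm
    rw [Submodule.map_span] at hJy
    exact Submodule.span_mono (Set.subset_insert φ _) hJy
  obtain ⟨f, hf, hle⟩ := hN2 _ _ hyV
  have hfx := hzero m f (hNM _ hf)
  rw [dist_eq_norm] at hxy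
  have h1 : ‖(J y - φ) f‖ ≤ ‖x - y‖ := by
    have : (J y - φ) f = - f (x - y) := by
      simp [J, dual_def, hfx]
    rw [this, norm_neg]
    exact (f.le_opNorm _).trans (mul_le_of_le_one_left (norm_nonneg _) (hN1 _ _ hf))
  have h2 : ‖J x - φ‖ ≤ ‖x - y‖ + ‖J y - φ‖ := by
    have : J x - φ = J (x - y) + (J y - φ) := by rw [map_sub, sub_add_sub_cancel]
    rw [this]
    exact (norm_add_le (J (x - y)) (J y - φ)).trans (add_le_add_left (double_dual_bound 𝕜 E _) _)
  linarith

open NormedSpace in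
/-- **Eberlein's theorem**: a bounded set in which every sequence has a weak cluster point (in the
whole space) is relatively weakly compact. -/
theorem isRelativelyWeaklyCompact_of_forall_mapClusterPt {A : Set E}
    (hbdd : Bornology.IsBounded A)
    (hA : ∀ a : ℕ → E, (∀ n, a n ∈ A) →
      ∃ x, MapClusterPt (toWeakSpace 𝕜 E x) atTop (fun n => toWeakSpace 𝕜 E (a n))) :
    IsRelativelyWeaklyCompact 𝕜 A := by
  refine isCompact_closure_of_isBounded 𝕜 E _ ?_ ?_
  · rwa [Set.preimage_image_eq _ (toWeakSpace 𝕜 E).injective]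
  intro φ hφ
  obtain ⟨x, hx⟩ := mem_range_inclusionInDoubleDual_of_forall_mapClusterPt hA
    (WeakDual.toStrongDual φ) (by
      intro F ε hε
      have hopen : IsOpen {ψ : WeakDual 𝕜 (StrongDual 𝕜 E) | ∀ f ∈ F, ‖φ f - ψ f‖ < ε} := by
        have : {ψ : WeakDual 𝕜 (StrongDual 𝕜 E) | ∀ f ∈ F, ‖φ f - ψ f‖ < ε} =
            ⋂ f ∈ F, {ψ : WeakDual 𝕜 (StrongDual 𝕜 E) | ‖φ f - ψ f‖ < ε} := by
          ext; simp
        rw [this]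
        exact isOpen_biInter_finset fun f _ => isOpen_lt
          (continuous_const.sub (WeakDual.eval_continuous f)).norm continuous_const
      obtain ⟨_, hψ, _, ⟨a, ha, rfl⟩, rfl⟩ :=
        mem_closure_iff.1 hφ _ hopen (fun f _ => by simpa using hε)
      exact ⟨a, ha, hψ⟩)
  exact ⟨toWeakSpace 𝕜 E x, congrArg StrongDual.toWeakDual hx⟩

end Eberlein

section Sequential

/-! ### Compactness properties determined by sequences -/

variable {𝕜 : Type*} [RCLike 𝕜] {E : Type*} [NormedAddCommGroup E] [NormedSpace 𝕜 E]

theorem isWeaklyPrecompact_of_forall_seq {A : Set E}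
    (hA : ∀ a : ℕ → E, (∀ n, a n ∈ A) → ∃ S, IsWeaklyPrecompact 𝕜 S ∧ ∀ n, a n ∈ S) :
    IsWeaklyPrecompact 𝕜 A := fun a ha =>
  let ⟨_, hS, haS⟩ := hA a ha
  hS a haS

theorem isRelativelyWeaklyCompact_of_forall_seq {A : Set E} (hbdd : Bornology.IsBounded A)
    (hA : ∀ a : ℕ → E, (∀ n, a n ∈ A) → ∃ S, IsRelativelyWeaklyCompact 𝕜 S ∧ ∀ n, a n ∈ S) :
    IsRelativelyWeaklyCompact 𝕜 A := by
  refine isRelativelyWeaklyCompact_of_forall_mapClusterPt hbdd fun a ha => ?_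
  obtain ⟨S, hS, haS⟩ := hA a ha
  obtain ⟨y, -, hy⟩ := hS.exists_mapClusterPt (f := atTop)
    (u := fun n => toWeakSpace 𝕜 E (a n)) (by
      rw [le_principal_iff, mem_map]
      exact Eventually.of_forall fun n => subset_closure ⟨a n, haS n, rfl⟩)
  exact ⟨(toWeakSpace 𝕜 E).symm y, by simpa using hy⟩

theorem isRelativelyNormCompact_of_forall_seq {A : Set E}
    (hA : ∀ a : ℕ → E, (∀ n, a n ∈ A) → ∃ S, IsRelativelyNormCompact S ∧ ∀ n, a n ∈ S) :
    IsRelativelyNormCompact A := by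
  refine IsSeqCompact.isCompact fun y hy => ?_
  choose a ha hya using fun n : ℕ =>
    Metric.mem_closure_iff.1 (hy n) (1 / ((n : ℝ) + 1)) (by positivity)
  obtain ⟨S, hS, haS⟩ := hA a ha
  obtain ⟨z, -, φ, hφ, hz⟩ := hS.tendsto_subseq fun n => subset_closure (haS n)
  have hlim : Tendsto (y ∘ φ) atTop (𝓝 z) := by
    refine (tendsto_iff_of_dist ?_).2 hz
    refine squeeze_zero (fun _ => dist_nonneg) (fun n => (hya (φ n)).le) ?_
    exact tendsto_one_div_add_atTop_nhds_zero_nat.comp hφ.tendsto_atTop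
  exact ⟨z, isClosed_closure.mem_of_tendsto hlim (Eventually.of_forall fun n => hy _), φ, hφ, hlim⟩

end Sequential

section Operators

/-! ### Weakly-`p`-Dunford–Pettis sets and operators with `p`-convergent adjoint -/

variable {𝕜 : Type*} [RCLike 𝕜]
variable {X : Type*} [NormedAddCommGroup X] [NormedSpace 𝕜 X]
variable {Y : Type*} [NormedAddCommGroup Y] [NormedSpace 𝕜 Y]
variable {Z : Type*} [NormedAddCommGroup Z] [NormedSpace 𝕜 Z]

theorem isWeaklyPDunfordPettis_image_closedBall {p : ℝ≥0∞} {T : Y →L[𝕜] X}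
    (hT : IsPConvergent p (banachAdjoint T)) :
    IsWeaklyPDunfordPettis 𝕜 p (T '' Metric.closedBall 0 1) := by
  refine ⟨T.lipschitz.isBounded_image Metric.isBounded_closedBall, fun f hf => ?_⟩
  refine squeeze_zero (fun n => Real.iSup_nonneg fun _ => norm_nonneg _) (fun n => ?_)
    (tendsto_zero_iff_norm_tendsto_zero.1 (hT f hf))
  refine Real.iSup_le ?_ (norm_nonneg _)
  rintro ⟨_, y, hy, rfl⟩
  rw [← banachAdjoint_apply]
  exact ((banachAdjoint T (f n)).le_opNorm y).trans
    (mul_le_of_le_one_right (norm_nonneg _) (by simpa using hy))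

theorem IsPConvergent.banachAdjoint_comp {p : ℝ≥0∞} {T : Y →L[𝕜] X}
    (hT : IsPConvergent p (banachAdjoint T)) (S : Z →L[𝕜] Y) :
    IsPConvergent p (banachAdjoint (T ∘L S)) := fun f hf => by
  have h := ((banachAdjoint S).continuous.tendsto 0).comp (hT f hf)
  rw [map_zero] at h
  exact h

theorem lp_one_hasSum_norm (c : lp (fun _ : ℕ => 𝕜) 1) : HasSum (fun n => ‖c n‖) ‖c‖ := by
  simpa using lp.hasSum_norm (by simp) c

/-- A bounded sequence in a Banach space defines an operator on `ℓ₁` mapping the unit vectors to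
the terms of the sequence. -/
theorem exists_lp_one_operator_hasSum [CompleteSpace X] {x : ℕ → X} {C : ℝ}
    (hx : ∀ n, ‖x n‖ ≤ C) :
    ∃ T : lp (fun _ : ℕ => 𝕜) 1 →L[𝕜] X, ∀ c, HasSum (fun n => c n • x n) (T c) := by
  have hle : ∀ (c : lp (fun _ : ℕ => 𝕜) 1) n, ‖c n • x n‖ ≤ ‖c n‖ * C := fun c n => by
    rw [norm_smul]; gcongr; exact hx n
  have hsum : ∀ c : lp (fun _ : ℕ => 𝕜) 1, Summable fun n => c n • x n := fun c =>
    Summable.of_norm_bounded ((lp_one_hasSum_norm c).summable.mul_right C) (hle c)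
  let T₀ : lp (fun _ : ℕ => 𝕜) 1 →ₗ[𝕜] X :=
    { toFun := fun c => ∑' n, c n • x n
      map_add' := fun c d => by
        rw [← (hsum c).tsum_add (hsum d)]
        simp [add_smul]
      map_smul' := fun r c => by
        rw [RingHom.id_apply, ← (hsum c).tsum_const_smul]
        simp [mul_smul] }
  refine ⟨T₀.mkContinuous C fun c => ?_, fun c => (hsum c).hasSum⟩
  rw [mul_comm]
  exact tsum_of_norm_bounded ((lp_one_hasSum_norm c).mul_right C) (hle c)

/-- Every sequence in a weakly-`p`-Dunford–Pettis set lies in the image of the unit ball under an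
operator on `ℓ₁` with `p`-convergent adjoint. -/
theorem IsWeaklyPDunfordPettis.exists_lp_one_operator [CompleteSpace X] {p : ℝ≥0∞} {A : Set X}
    (hA : IsWeaklyPDunfordPettis 𝕜 p A) {x : ℕ → X} (hx : ∀ n, x n ∈ A) :
    ∃ T : lp (fun _ : ℕ => 𝕜) 1 →L[𝕜] X, IsPConvergent p (banachAdjoint T) ∧
      ∀ n, x n ∈ T '' Metric.closedBall 0 1 := by
  classical
  obtain ⟨C, hC⟩ := hA.1.exists_norm_le
  obtain ⟨T, hT⟩ := exists_lp_one_operator_hasSum (𝕜 := 𝕜) fun n => hC _ (hx n)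
  refine ⟨T, fun f hf => ?_, fun n => ⟨lp.single 1 n 1, ?_, ?_⟩⟩
  · refine squeeze_zero_norm (fun n => ?_) (hA.2 f hf)
    have hbdd : BddAbove (Set.range fun a : A => ‖f n (a : X)‖) := by
      refine ⟨‖f n‖ * C, ?_⟩
      rintro _ ⟨a, rfl⟩
      exact (f n).le_opNorm_of_le (hC _ a.2)
    refine ContinuousLinearMap.opNorm_le_bound _ (Real.iSup_nonneg fun _ => norm_nonneg _)
      fun c => ?_
    rw [banachAdjoint_apply, ← ((f n).hasSum (hT c)).tsum_eq, mul_comm]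
    refine tsum_of_norm_bounded ((lp_one_hasSum_norm c).mul_right _) fun k => ?_
    change ‖f n (c k • x k)‖ ≤ _
    rw [map_smul, norm_smul]
    gcongr
    exact le_ciSup hbdd ⟨x k, hx k⟩
  · rw [mem_closedBall_zero_iff, lp.norm_single (by simp), norm_one]
  · refine (hT _).unique ?_
    convert hasSum_single n fun k hk => ?_ using 1
    · simp
    · rw [lp.single_apply_ne _ _ _ hk, zero_smul]

theorem isCompactOperator_iff_image_closedBall (T : Y →L[𝕜] X) :
    IsCompactOperator T ↔ IsRelativelyNormCompact (T '' Metric.closedBall 0 1) :=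
  isCompactOperator_iff_isCompact_closure_image_closedBall (T : Y →ₗ[𝕜] X) zero_lt_one

end Operators

/-- The equivalence for an arbitrary property `P` of subsets of `X` which a bounded set has as soon
as each sequence in it lies in a set with property `P`. -/
theorem tfae_of_sequential {𝕜 : Type} [RCLike 𝕜] (p : ℝ≥0∞)
    (X : Type u) [NormedAddCommGroup X] [NormedSpace 𝕜 X] [CompleteSpace X] (P : Set X → Prop)
    (hP : ∀ A : Set X, Bornology.IsBounded A →
      (∀ a : ℕ → X, (∀ n, a n ∈ A) → ∃ S, P S ∧ ∀ n, a n ∈ S) → P A) :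
    [ ∀ (Y : Type v) [NormedAddCommGroup Y] [NormedSpace 𝕜 Y] [CompleteSpace Y] (T : Y →L[𝕜] X),
        IsPConvergent p (banachAdjoint T) → P (T '' Metric.closedBall 0 1),
      ∀ T : lp (fun _ : ℕ => 𝕜) 1 →L[𝕜] X,
        IsPConvergent p (banachAdjoint T) → P (T '' Metric.closedBall 0 1),
      ∀ A : Set X, IsWeaklyPDunfordPettis 𝕜 p A → P A ].TFAE := by
  tfae_have 1 → 2 := fun h T hT => by
    -- A copy of `ℓ₁` in the universe over which `Y` ranges.
    let e : ULift.{v} (lp (fun _ : ℕ => 𝕜) 1) ≃ₗᵢ[𝕜] lp (fun _ : ℕ => 𝕜) 1 :=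
      LinearIsometryEquiv.ulift 𝕜 _
    have := h _ (T ∘L e.toContinuousLinearEquiv.toContinuousLinearMap) (hT.banachAdjoint_comp _)
    rw [ContinuousLinearMap.coe_comp, Set.image_comp] at this
    have he : e.toContinuousLinearEquiv.toContinuousLinearMap '' Metric.closedBall 0 1
        = Metric.closedBall 0 1 := by
      simp
    rwa [he] at this
  tfae_have 2 → 3 := fun h A hA => hP A hA.1 fun a ha =>
    let ⟨T, hT, haT⟩ := hA.exists_lp_one_operator ha
    ⟨_, h T hT, haT⟩
  tfae_have 3 → 1 := fun h Y _ _ _ T hT => h _ (isWeaklyPDunfordPettis_image_closedBall hT)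
  tfae_finish

theorem mainTheorem5 {𝕜 : Type} [RCLike 𝕜] (p : ℝ≥0∞) (hp : 1 ≤ p) (hp' : p ≠ ∞)
    (X : Type u) [NormedAddCommGroup X] [NormedSpace 𝕜 X] [CompleteSpace X] :
    -- the weakly precompact case
    [ ∀ (Y : Type v) [NormedAddCommGroup Y] [NormedSpace 𝕜 Y] [CompleteSpace Y] (T : Y →L[𝕜] X),
        IsPConvergent p (banachAdjoint T) → IsWeaklyPrecompactOperator T,
      ∀ T : lp (fun _ : ℕ => 𝕜) 1 →L[𝕜] X,
        IsPConvergent p (banachAdjoint T) → IsWeaklyPrecompactOperator T,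
      ∀ A : Set X, IsWeaklyPDunfordPettis 𝕜 p A → IsWeaklyPrecompact 𝕜 A ].TFAE ∧
    -- the weakly compact case, which characterizes property `RDP*_p`
    [ ∀ (Y : Type v) [NormedAddCommGroup Y] [NormedSpace 𝕜 Y] [CompleteSpace Y] (T : Y →L[𝕜] X),
        IsPConvergent p (banachAdjoint T) → IsWeaklyCompactOperator T,
      ∀ T : lp (fun _ : ℕ => 𝕜) 1 →L[𝕜] X,
        IsPConvergent p (banachAdjoint T) → IsWeaklyCompactOperator T,
      ∀ A : Set X, IsWeaklyPDunfordPettis 𝕜 p A → IsRelativelyWeaklyCompact 𝕜 A,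
      HasRDPStar 𝕜 X p ].TFAE ∧
    -- the compact case
    [ ∀ (Y : Type v) [NormedAddCommGroup Y] [NormedSpace 𝕜 Y] [CompleteSpace Y] (T : Y →L[𝕜] X),
        IsPConvergent p (banachAdjoint T) → IsCompactOperator T,
      ∀ T : lp (fun _ : ℕ => 𝕜) 1 →L[𝕜] X,
        IsPConvergent p (banachAdjoint T) → IsCompactOperator T,
      ∀ A : Set X, IsWeaklyPDunfordPettis 𝕜 p A → IsRelativelyNormCompact A ].TFAE := by
  refine ⟨?_, ?_, ?_⟩
  · exact tfae_of_sequential p X (IsWeaklyPrecompact 𝕜) fun A _ h =>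
      isWeaklyPrecompact_of_forall_seq h
  · have h := tfae_of_sequential.{u, v} (𝕜 := 𝕜) p X (IsRelativelyWeaklyCompact 𝕜) fun A hA h =>
      isRelativelyWeaklyCompact_of_forall_seq hA h
    tfae_have 1 ↔ 2 := h.out 0 1
    tfae_have 2 ↔ 3 := h.out 1 2
    tfae_have 3 ↔ 4 := Iff.rfl
    tfae_finish
  · have h := tfae_of_sequential.{u, v} (𝕜 := 𝕜) p X IsRelativelyNormCompact fun A _ h =>
      isRelativelyNormCompact_of_forall_seq h
    simp only [isCompactOperator_iff_image_closedBall]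
    exact h
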